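/- Let $P$ be a simplicial polytope of dimension $d+1$ with $n$ vertices (the convex hull of finitely many points in a finite-dimensional real vector space, all of whose proper faces are simplices), and let $C=\partial P$ be its boundary complex, i.e. the pure simplicial $d$-complex of vertex sets of proper faces of $P$. Suppose that $P$ is flag, that is, every inclusion-minimal non-face of $C$ (a set of vertices of $C$ that is not a face while all its proper subsets are faces) has exactly two elements. Then $C$ has the non-revisiting path property: for any two facets $X,Y$ of $C$ there is a sequence of facets $X=\Gamma(0),\Gamma(1),\dots,\Gamma(\ell)=Y$ such that $\Gamma(i)\cap\Gamma(i+1)$ has dimension $d-1$ for all $i$, and such that, whenever $i\le j$ and both $\Gamma(i)$ and $\Gamma(j)$ lie in the star $\mathrm{St}(v,C)=\{\tau\in C:\tau\cup\{v\}\in C\}$ of a vertex $v$ of $C$, all $\Gamma(k)$ with $i\le k\le j$ lie in $\mathrm{St}(v,C)$. In particular, $C$ satisfies the Hirsch diameter bound: the facet-ridge graph of $C$ (whose vertices are the facets of $C$, two of them adjacent if they have a $(d-1)$-face in common) is connected and has diameter at most $n-(d+1)$. -/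

import Mathlib

/-! ### Abstract simplicial complexes

Complexes are Mathlib's `PreAbstractSimplicialComplex`: a downward closed family of nonempty finite
sets of points. The vertices are the points `v` with `{v} ∈ K.faces`; the empty face is left
implicit. -/

namespace PreAbstractSimplicialComplex

variable {V : Type*}

/-- The vertices of a simplicial complex. -/
def vertices (K : PreAbstractSimplicialComplex V) : Set V :=
  {v | {v} ∈ K.faces}

/-- The facets of a simplicial complex: its inclusion-maximal faces. -/
def facets (K : PreAbstractSimplicialComplex V) : Set (Finset V) :=
  {s | Maximal (· ∈ K.faces) s}

/-- A complex is pure if all its facets have the same dimension. -/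
def IsPure (K : PreAbstractSimplicialComplex V) : Prop :=
  ∀ s ∈ K.facets, ∀ t ∈ K.facets, s.card = t.card

/-- `s` is an inclusion-minimal non-face of `K`: a nonempty set of vertices that is not a face,
all of whose nonempty proper subsets are faces. -/
def IsMinimalNonface (K : PreAbstractSimplicialComplex V) (s : Finset V) : Prop :=
  s.Nonempty ∧ (s : Set V) ⊆ K.vertices ∧ s ∉ K.faces ∧ ∀ t ⊂ s, t.Nonempty → t ∈ K.faces

/-- A complex is flag if every inclusion-minimal non-face has two elements. -/
def IsFlag (K : PreAbstractSimplicialComplex V) : Prop :=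
  ∀ s, K.IsMinimalNonface s → s.card = 2

open Classical in
/-- The star of `s` in `K`: the faces `t` of `K` such that `t ∪ s` is a face of `K`. -/
def star (K : PreAbstractSimplicialComplex V) (s : Finset V) : Set (Finset V) :=
  {t | t ∈ K.faces ∧ t ∪ s ∈ K.faces}

open Classical in
/-- The dual graph, or facet-ridge graph, of a pure complex: its vertices are the facets of `K`,
and two facets are adjacent if their intersection has dimension one less than the facets. (For
zero-dimensional complexes the intersection is the empty face, of dimension `-1`.) -/
def dualGraph (K : PreAbstractSimplicialComplex V) : SimpleGraph K.facets where
  Adj s t := ((s : Finset V) ∩ t).card + 1 = (s : Finset V).card ∧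
    ((s : Finset V) ∩ t).card + 1 = (t : Finset V).card
  symm := ⟨fun s t h => by rw [Finset.inter_comm]; exact ⟨h.2, h.1⟩⟩
  loopless := ⟨fun s h => by simp at h⟩

/-- A facet path, that is, a walk in the dual graph, is non-revisiting if whenever the facets at
times `i ≤ j` lie in the star of a vertex `v`, so do all the facets in between. -/
def IsNonRevisiting (K : PreAbstractSimplicialComplex V) {X Y : K.facets}
    (p : K.dualGraph.Walk X Y) : Prop :=
  ∀ v ∈ K.vertices, ∀ i j : ℕ, i ≤ j → j ≤ p.length →
    (p.getVert i : Finset V) ∈ K.star {v} → (p.getVert j : Finset V) ∈ K.star {v} →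
      ∀ k, i ≤ k → k ≤ j → (p.getVert k : Finset V) ∈ K.star {v}

/-- The non-revisiting path property (`W_v`-property): `K` is pure and any two facets of `K` are
connected by a non-revisiting facet path. -/
def HasNonRevisitingPathProperty (K : PreAbstractSimplicialComplex V) : Prop :=
  K.IsPure ∧ ∀ X Y : K.facets, ∃ p : K.dualGraph.Walk X Y, K.IsNonRevisiting p

end PreAbstractSimplicialComplex

/-! ### Simplicial polytopes and their boundary complexes -/

section Polytope

variable {E : Type*} [NormedAddCommGroup E] [NormedSpace ℝ E]

/-- A (convex) polytope: the convex hull of finitely many points. -/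
def IsPolytope (P : Set E) : Prop :=
  ∃ V : Finset E, P = convexHull ℝ (V : Set E)

/-- A proper face of a polytope `P`: a set other than `P` that is either empty or the set of
maximizers over `P` of some linear functional. -/
def IsProperFace (P F : Set E) : Prop :=
  IsExposed ℝ P F ∧ F ≠ P

/-- A simplicial polytope: every proper face is a simplex, i.e. the convex hull of an affinely
independent finite set. -/
def IsSimplicialPolytope (P : Set E) : Prop :=
  IsPolytope P ∧ ∀ F, IsProperFace P F →
    ∃ s : Finset E, AffineIndependent ℝ ((↑) : s → E) ∧ F = convexHull ℝ (s : Set E)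

/-- An exposed face of an exposed face of a polytope is an exposed face of the polytope. -/
theorem IsPolytope.isExposed_trans {P F G : Set E} (hP : IsPolytope P)
    (hF : IsExposed ℝ P F) (hG : IsExposed ℝ F G) : IsExposed ℝ P G := by
  intro hne
  obtain ⟨m, hm⟩ := hG hne
  obtain ⟨g, hg⟩ := hne
  have hgF : g ∈ F := hG.subset hg
  obtain ⟨l, hl⟩ := hF ⟨g, hgF⟩
  obtain ⟨V, rfl⟩ := hP
  have hgP : g ∈ convexHull ℝ (V : Set E) := hF.subset hgF
  have hlmax : ∀ y ∈ convexHull ℝ (V : Set E), l y ≤ l g := by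
    rw [hl] at hgF; exact hgF.2
  have hmmax : ∀ y ∈ F, m y ≤ m g := by
    rw [hm] at hg; exact hg.2
  -- a small perturbation of `l` by `m` is still bounded on `V` by its value at `g`
  have key : ∃ ε : ℝ, 0 < ε ∧ ∀ v ∈ V, l v + 2 * ε * m v ≤ l g + 2 * ε * m g := by
    have h1 : ∀ v ∈ V, ∀ᶠ ε : ℝ in nhdsWithin 0 (Set.Ioi 0),
        l v + 2 * ε * m v ≤ l g + 2 * ε * m g := by
      intro v hv
      have hvP : v ∈ convexHull ℝ (V : Set E) := subset_convexHull ℝ _ hv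
      rcases (hlmax v hvP).lt_or_eq with h | h
      · have hc1 : Filter.Tendsto (fun ε : ℝ => l v + 2 * ε * m v) (nhds 0)
            (nhds (l v + 2 * 0 * m v)) :=
          (by fun_prop : Continuous fun ε : ℝ => l v + 2 * ε * m v).tendsto 0
        have hc2 : Filter.Tendsto (fun ε : ℝ => l g + 2 * ε * m g) (nhds 0)
            (nhds (l g + 2 * 0 * m g)) :=
          (by fun_prop : Continuous fun ε : ℝ => l g + 2 * ε * m g).tendsto 0
        have := hc1.eventually_lt hc2 (by simpa using h)
        exact (this.filter_mono nhdsWithin_le_nhds).mono fun _ h => h.le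
      · have hvF : v ∈ F := by
          rw [hl]; exact ⟨hvP, fun y hy => h ▸ hlmax y hy⟩
        filter_upwards [self_mem_nhdsWithin] with ε hε
        have := mul_le_mul_of_nonneg_left (hmmax v hvF) (by
          have : (0 : ℝ) < ε := hε
          positivity : 0 ≤ 2 * ε)
        linarith
    have h2 := (Finset.eventually_all V).2 h1
    obtain ⟨ε, hε, h⟩ := (h2.and self_mem_nhdsWithin).exists
    exact ⟨ε, h, hε⟩
  obtain ⟨ε, hε, hV⟩ := key
  have hP2 : ∀ x ∈ convexHull ℝ (V : Set E), l x + 2 * ε * m x ≤ l g + 2 * ε * m g := by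
    have hconv : Convex ℝ {x : E | (l + (2 * ε) • m) x ≤ l g + 2 * ε * m g} :=
      convex_halfSpace_le (l + (2 * ε) • m).toLinearMap.isLinear _
    intro x hx
    have := convexHull_min (s := (V : Set E)) (fun v hv => by simpa using hV v hv) hconv hx
    simpa using this
  refine ⟨l + ε • m, ?_⟩
  ext x
  simp only [Set.mem_ofPred_eq, add_apply, smul_apply, smul_eq_mul]
  constructor
  · intro hx
    have hxF := hG.subset hx
    have e1 : l g ≤ l x := by rw [hl] at hxF; exact hxF.2 g hgP
    have e2 : m g ≤ m x := by rw [hm] at hx; exact hx.2 g hgF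
    have e3 := mul_le_mul_of_nonneg_left e2 hε.le
    refine ⟨hF.subset hxF, fun y hy => ?_⟩
    have := hP2 y hy
    have := hlmax y hy
    linarith
  · rintro ⟨hxP, hx⟩
    have e1 := hx g hgP
    have e2 := hP2 x hxP
    have e3 := hlmax x hxP
    have hxF : x ∈ F := by
      rw [hl]; exact ⟨hxP, fun y hy => (hlmax y hy).trans (by linarith)⟩
    have e4 : m g ≤ m x := by
      have : ε * m g ≤ ε * m x := by linarith
      exact le_of_mul_le_mul_left this hε
    rw [hm]
    exact ⟨hxF, fun y hy => (hmmax y hy).trans e4⟩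

/-- A face of a simplex, obtained by dropping one vertex, is an exposed face of the simplex. -/
theorem isExposed_convexHull_erase [FiniteDimensional ℝ E] [DecidableEq E] {s : Finset E}
    (hs : AffineIndependent ℝ ((↑) : s → E)) {v : E} (hv : v ∈ s) :
    IsExposed ℝ (convexHull ℝ (s : Set E)) (convexHull ℝ ((s.erase v : Finset E) : Set E)) := by
  rintro hne
  obtain ⟨t, hst, ht, hspan⟩ := exists_subset_affineIndependent_affineSpan_eq_top hs
  let b : AffineBasis t ℝ E := ⟨(↑), ht, by simpa using hspan⟩
  let f : E →ᵃ[ℝ] ℝ := b.coord ⟨v, hst hv⟩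
  have hfv : f v = 1 := b.coord_apply_eq ⟨v, hst hv⟩
  have hfs : ∀ w ∈ s, w ≠ v → f w = 0 := by
    intro w hw hwv
    exact b.coord_apply_ne (i := ⟨v, hst hv⟩) (j := ⟨w, hst hw⟩)
      (fun h => hwv (congrArg Subtype.val h).symm)
  have hle : ∀ x y : E, f.linear x ≤ f.linear y ↔ f x ≤ f y := by
    intro x y
    have := f.linearMap_vsub x y
    simp only [vsub_eq_sub, map_sub] at this
    constructor <;> intro h <;> linarith
  have hsum : ∀ w : E → ℝ, ∑ i ∈ s, w i = 1 → f (∑ i ∈ s, w i • i) = w v := by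
    intro w hw
    have := s.map_affineCombination (fun i : E => i) w hw f
    rw [s.affineCombination_eq_linear_combination _ _ hw,
      s.affineCombination_eq_linear_combination _ _ hw] at this
    rw [this, Finset.sum_eq_single_of_mem v hv]
    · simp [hfv]
    · intro i hi hiv
      simp [hfs i hi hiv]
  have hnonneg : ∀ x ∈ convexHull ℝ (s : Set E), 0 ≤ f x := by
    intro x hx
    obtain ⟨w, hw0, hw1, rfl⟩ := Finset.mem_convexHull'.1 hx
    rw [hsum w hw1]; exact hw0 v hv
  have hzero : ∀ x ∈ convexHull ℝ ((s.erase v : Finset E) : Set E), f x = 0 := by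
    intro x hx
    have : Convex ℝ (f ⁻¹' {0}) := (convex_singleton (0 : ℝ)).affine_preimage f
    exact convexHull_min (fun w hw => by
      have hw' := Finset.mem_erase.1 (Finset.mem_coe.1 hw)
      exact hfs w hw'.2 hw'.1) this hx
  obtain ⟨g, hg⟩ := hne
  have hsub : convexHull ℝ ((s.erase v : Finset E) : Set E) ⊆ convexHull ℝ (s : Set E) :=
    convexHull_mono (by simp)
  refine ⟨-(LinearMap.toContinuousLinearMap f.linear), ?_⟩
  ext x
  simp only [Set.mem_ofPred_eq, neg_apply, LinearMap.coe_toContinuousLinearMap', neg_le_neg_iff,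
    hle]
  constructor
  · intro hx
    exact ⟨hsub hx, fun y hy => by rw [hzero x hx]; exact hnonneg y hy⟩
  · rintro ⟨hx, hmin⟩
    have h0 : f x ≤ 0 := (hmin g (hsub hg)).trans_eq (hzero g hg)
    obtain ⟨w, hw0, hw1, rfl⟩ := Finset.mem_convexHull'.1 hx
    rw [hsum w hw1] at h0
    have hwv : w v = 0 := le_antisymm h0 (hw0 v hv)
    refine Finset.mem_convexHull'.2 ⟨w, fun y hy => hw0 y (Finset.mem_of_mem_erase hy), ?_, ?_⟩
    · rw [← hw1, ← Finset.add_sum_erase s w hv, hwv, zero_add]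
    · rw [← Finset.add_sum_erase s (fun i => w i • i) hv, hwv, zero_smul, zero_add]

/-- Nonempty subsets of the vertex set of a proper simplex face again span proper faces. -/
theorem IsPolytope.isProperFace_convexHull_subset [FiniteDimensional ℝ E] {P : Set E}
    (hP : IsPolytope P) {s t : Finset E} (hs : AffineIndependent ℝ ((↑) : s → E))
    (hsP : IsProperFace P (convexHull ℝ (s : Set E))) (hts : t ⊆ s) :
    IsProperFace P (convexHull ℝ (t : Set E)) := by
  classical
  induction s using Finset.strongInduction with
  | H s ih =>
    rcases hts.eq_or_ssubset with rfl | hlt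
    · exact hsP
    · obtain ⟨v, hv, hvt⟩ := Finset.exists_of_ssubset hlt
      have hsub : s.erase v ⊆ s := Finset.erase_subset v s
      have hexp := isExposed_convexHull_erase hs hv
      refine ih (s.erase v) (Finset.erase_ssubset hv) (hs.mono hsub)
        ⟨hP.isExposed_trans hsP.1 hexp, fun h => hsP.2 ?_⟩ (Finset.subset_erase.2 ⟨hts, hvt⟩)
      exact hsP.1.subset.antisymm (h ▸ hexp.subset)

/-- The boundary complex of a simplicial polytope `P`: its faces are the vertex sets of the
nonempty proper faces of `P`, that is, the nonempty affinely independent sets whose convex hull is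
a proper face of `P`. -/
def boundaryComplex [FiniteDimensional ℝ E] (P : Set E) (hP : IsSimplicialPolytope P) :
    PreAbstractSimplicialComplex E where
  faces := {s | s.Nonempty ∧ AffineIndependent ℝ ((↑) : s → E) ∧
    IsProperFace P (convexHull ℝ (s : Set E))}
  isRelLowerSet_faces := fun _ hs =>
    ⟨hs.1, fun _ hts ht => ⟨ht, hs.2.1.mono hts,
      hP.1.isProperFace_convexHull_subset hs.2.1 hs.2.2 hts⟩⟩

end Polytope

/-! The proof uses combinatorial segments. Only three properties of the complex enter
(`IsNormalFlag`): purity, cliques lie in facets, and the facets containing a given set are connected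
through such facets.

For facets `X`, `Y` containing `σ`, induct on `N - σ.card`. A common vertex outside `σ` is added to
`σ`. Otherwise a segment leads from `X`, inside the star of `σ`, to a facet `Z` meeting `Y \ σ` in
one vertex `z`, and induction leads from `Z` to `Y` inside the star of `σ ∪ {z}`. A vertex met on
both legs is joined to `z`; segments are built so that all such vertices lie in `Z`, hence nothing
is revisited.

Segments (`exists_segment_of_distance`) descend the graph distance to the target in the link of `σ`:
staying in the star of a nearest vertex `x`, a segment for `σ ∪ {x}` reaches a neighbour of `x` one
step closer, and so on.

For the polytope, put the origin at the barycentre of the vertices, so that faces are cut out by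
functionals at most `1` on all vertices (`isSupportComplex_boundaryComplex`). Purity follows by
pivoting, connectedness by the simplex method (`reflTransGen_adj`), the clique condition from
flagness (`IsFlag.mem_faces`). The diameter bound holds because each step of a non-revisiting path
meets a new vertex. -/

namespace PreAbstractSimplicialComplex

variable {V : Type*}

/-! ### Joined vertices and links -/

/-- Two points are joined if some face contains both of them. On vertices this is reflexive. -/
def Joined (K : PreAbstractSimplicialComplex V) (u v : V) : Prop :=
  ∃ s ∈ K.faces, u ∈ s ∧ v ∈ s

theorem Joined.symm {K : PreAbstractSimplicialComplex V} {u v : V} (h : K.Joined u v) :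
    K.Joined v u := by
  obtain ⟨s, hs, hu, hv⟩ := h
  exact ⟨s, hs, hv, hu⟩

theorem joined_of_mem_facet {K : PreAbstractSimplicialComplex V} (X : K.facets) {u v : V}
    (hu : u ∈ X.1) (hv : v ∈ X.1) : K.Joined u v :=
  ⟨X.1, X.2.prop, hu, hv⟩

/-- The vertices outside `σ` joined to all elements of `σ`. In a flag complex these are the vertices
of the link of the face `σ`. -/
def LinkVertex (K : PreAbstractSimplicialComplex V) (σ : Finset V) (v : V) : Prop :=
  v ∉ σ ∧ K.Joined v v ∧ ∀ u ∈ σ, K.Joined u v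

theorem linkVertex_of_mem_facet {K : PreAbstractSimplicialComplex V} {σ : Finset V} (X : K.facets)
    (hσ : σ ⊆ X.1) {v : V} (hv : v ∈ X.1) (hvσ : v ∉ σ) : K.LinkVertex σ v :=
  ⟨hvσ, joined_of_mem_facet X hv hv, fun _ hu => joined_of_mem_facet X (hσ hu) hv⟩

/-! ### Non-revisiting paths and their concatenation -/

/-- There is a non-revisiting facet path from `X` to `Y` whose facets cover exactly the set `U`. -/
def NonRevisitingPath (K : PreAbstractSimplicialComplex V) (X Y : K.facets) (U : Set V) : Prop :=
  ∃ p : K.dualGraph.Walk X Y,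
    (∀ v i j k, i ≤ k → k ≤ j → v ∈ (p.getVert i).1 → v ∈ (p.getVert j).1 →
      v ∈ (p.getVert k).1) ∧
    ∀ v, v ∈ U ↔ ∃ i, v ∈ (p.getVert i).1

namespace NonRevisitingPath

variable {K : PreAbstractSimplicialComplex V} {X Y Z : K.facets} {U U₁ U₂ : Set V}

theorem refl (X : K.facets) : K.NonRevisitingPath X X {v | v ∈ X.1} :=
  ⟨.nil, fun _ _ _ _ _ _ h _ => by simpa using h, fun _ => by simp⟩

theorem of_adj (h : K.dualGraph.Adj X Y) :
    K.NonRevisitingPath X Y {v | v ∈ X.1 ∨ v ∈ Y.1} := by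
  refine ⟨.cons h .nil, fun v i j k hik hkj hi hj => ?_, fun v => ?_⟩
  · rcases k with _ | k
    · obtain rfl : i = 0 := by lia
      exact hi
    · rcases j with _ | j
      · lia
      · simpa using hj
  · constructor
    · rintro (hv | hv)
      · exact ⟨0, by simpa using hv⟩
      · exact ⟨1, by simpa using hv⟩
    · rintro ⟨_ | i, hi⟩
      · exact Or.inl (by simpa using hi)
      · exact Or.inr (by simpa using hi)

/-- Only the joint matters: a vertex visited on both sides lies in `Z`, so it persists up to the
joint and from the joint on. -/
theorem trans (h₁ : K.NonRevisitingPath X Z U₁) (h₂ : K.NonRevisitingPath Z Y U₂)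
    (h : ∀ v ∈ U₁, v ∈ U₂ → v ∈ Z.1) : K.NonRevisitingPath X Y (U₁ ∪ U₂) := by
  obtain ⟨p, hp, hpU⟩ := h₁
  obtain ⟨q, hq, hqU⟩ := h₂
  refine ⟨p.append q, fun v i j k hik hkj hi hj => ?_, fun v => ?_⟩
  · rw [SimpleGraph.Walk.getVert_append] at hi hj ⊢
    by_cases hja : j < p.length
    · rw [if_pos (by lia)] at hi hj ⊢
      exact hp v i j k hik hkj hi hj
    rw [if_neg hja] at hj
    by_cases hia : i < p.length
    · rw [if_pos hia] at hi
      have hZ := h v ((hpU v).2 ⟨_, hi⟩) ((hqU v).2 ⟨_, hj⟩)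
      split_ifs with hka
      · exact hp v i p.length k hik hka.le hi (by simpa using hZ)
      · exact hq v 0 (j - p.length) _ (by lia) (by lia) (by simpa using hZ) hj
    · rw [if_neg hia] at hi
      rw [if_neg (by lia)]
      exact hq v _ _ _ (by lia) (by lia) hi hj
  · constructor
    · rintro (hv | hv)
      · obtain ⟨i, hi⟩ := (hpU v).1 hv
        by_cases hia : i < p.length
        · exact ⟨i, by rwa [SimpleGraph.Walk.getVert_append, if_pos hia]⟩
        · rw [p.getVert_of_length_le (by lia)] at hi
          exact ⟨p.length, by rw [SimpleGraph.Walk.getVert_append]; simpa using hi⟩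
      · obtain ⟨i, hi⟩ := (hqU v).1 hv
        refine ⟨p.length + i, ?_⟩
        rw [SimpleGraph.Walk.getVert_append, if_neg (by lia)]
        simpa using hi
    · rintro ⟨i, hi⟩
      rw [SimpleGraph.Walk.getVert_append] at hi
      split_ifs at hi
      · exact Or.inl ((hpU v).2 ⟨_, hi⟩)
      · exact Or.inr ((hqU v).2 ⟨_, hi⟩)

/-- A non-revisiting path keeps everything its two ends share, so it stays in the star of `X ∩ Y`.
-/
theorem exists_facet (h : K.NonRevisitingPath X Y U) {v : V} (hv : v ∈ U) :
    ∃ Z : K.facets, v ∈ Z.1 ∧ ∀ u, u ∈ X.1 → u ∈ Y.1 → u ∈ Z.1 := by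
  obtain ⟨p, hp, hpU⟩ := h
  obtain ⟨i, hi⟩ := (hpU v).1 hv
  refine ⟨p.getVert i, hi, fun u hX hY => ?_⟩
  -- `getVert` is constant past the end, so time `i + p.length` is at least `i` and sits at `Y`.
  exact hp u 0 (i + p.length) i (by lia) (by lia) (by simpa using hX)
    (by rw [p.getVert_of_length_le (by lia)]; exact hY)

theorem joined (h : K.NonRevisitingPath X Y U) {u v : V} (hv : v ∈ U) (hX : u ∈ X.1)
    (hY : u ∈ Y.1) : K.Joined u v := by
  obtain ⟨Z, hZ, hZu⟩ := h.exists_facet hv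
  exact joined_of_mem_facet Z (hZu u hX hY) hZ

theorem linkVertex (h : K.NonRevisitingPath X Y U) {σ : Finset V} {v : V} (hv : v ∈ U)
    (hX : σ ⊆ X.1) (hY : σ ⊆ Y.1) (hvσ : v ∉ σ) : K.LinkVertex σ v := by
  obtain ⟨Z, hZ, hZu⟩ := h.exists_facet hv
  exact linkVertex_of_mem_facet Z (fun u hu => hZu u (hX hu) (hY hu)) hZ hvσ

theorem mem_of_mem_right (h : K.NonRevisitingPath X Y U) {v : V} (hv : v ∈ Y.1) : v ∈ U := by
  obtain ⟨p, -, hpU⟩ := h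
  exact (hpU v).2 ⟨p.length, by simpa using hv⟩

theorem mem_of_mem_left (h : K.NonRevisitingPath X Y U) {v : V} (hv : v ∈ X.1) : v ∈ U := by
  obtain ⟨p, -, hpU⟩ := h
  exact (hpU v).2 ⟨0, by simpa using hv⟩

end NonRevisitingPath

/-! ### Normal flag complexes and combinatorial segments -/

/-- A complex with facets of cardinality `N` in which cliques span faces, and in which the facets
containing any given set are connected through facets containing that set. -/
structure IsNormalFlag (K : PreAbstractSimplicialComplex V) (N : ℕ) : Prop where
  card_eq : ∀ X : K.facets, X.1.card = N
  exists_facet : ∀ s : Finset V, s.Nonempty → (∀ u ∈ s, ∀ v ∈ s, K.Joined u v) →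
    ∃ X : K.facets, s ⊆ X.1
  connected : ∀ (σ : Finset V) (X Y : K.facets), σ ⊆ X.1 → σ ⊆ Y.1 →
    Relation.ReflTransGen (fun A B : K.facets => K.dualGraph.Adj A B ∧ σ ⊆ B.1) X Y

/-- A combinatorial segment from the facet `X` to the set `S`: a non-revisiting path to a facet `Y`
containing `σ` that meets `S` in `y` only, such that `Y` contains all visited vertices joined to
`y`. -/
structure IsSegment (K : PreAbstractSimplicialComplex V) (σ : Finset V) (X : K.facets) (S : Set V)
    (Y : K.facets) (y : V) (U : Set V) : Prop where
  path : K.NonRevisitingPath X Y U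
  subset : σ ⊆ Y.1
  mem : y ∈ Y.1
  mem_target : y ∈ S
  mem_of_joined : ∀ v ∈ U, K.Joined v y → v ∈ Y.1
  eq_of_mem : ∀ v ∈ U, v ∈ S → v = y

/-- Segments from facets containing `σ` to sets of vertices of the link of `σ` exist. -/
def HasSegments (K : PreAbstractSimplicialComplex V) (σ : Finset V) : Prop :=
  ∀ (X : K.facets) (S : Set V), σ ⊆ X.1 → S.Nonempty → (∀ v ∈ S, K.LinkVertex σ v) →
    (∀ v ∈ X.1, v ∉ S) → ∃ Y y U, K.IsSegment σ X S Y y U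

/-- `δ` behaves on the link of `σ` like the graph distance to the set `S`. -/
structure IsDistance (K : PreAbstractSimplicialComplex V)
    (σ : Finset V) (S : Set V) (δ : V → ℕ) : Prop where
  mem_of_eq_zero : ∀ v, K.LinkVertex σ v → δ v = 0 → v ∈ S
  eq_zero : ∀ v ∈ S, δ v = 0
  le_succ : ∀ u v, K.LinkVertex σ u → K.LinkVertex σ v → K.Joined u v → δ u ≤ δ v + 1
  exists_pred : ∀ v k, K.LinkVertex σ v → δ v = k + 1 →
    ∃ w, K.LinkVertex σ w ∧ K.Joined v w ∧ δ w = k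

/-- There is a walk of length `n` from the given vertex to `S` in the link of `σ`. -/
inductive Reaches (K : PreAbstractSimplicialComplex V)
    (σ : Finset V) (S : Set V) : ℕ → V → Prop
  | zero (v : V) : v ∈ S → K.Reaches σ S 0 v
  | succ (n : ℕ) (v w : V) : K.Reaches σ S n w → K.LinkVertex σ v → K.LinkVertex σ w →
      K.Joined v w → K.Reaches σ S (n + 1) v

namespace IsNormalFlag

variable {K : PreAbstractSimplicialComplex V} {N : ℕ}

open Classical in
theorem exists_facet_insert (hK : K.IsNormalFlag N) {σ : Finset V} {X : K.facets} (hσ : σ ⊆ X.1)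
    {v : V} (hv : K.LinkVertex σ v) : ∃ Y : K.facets, insert v σ ⊆ Y.1 := by
  refine hK.exists_facet _ ⟨v, by simp⟩ fun u hu w hw => ?_
  rcases Finset.mem_insert.1 hu with rfl | hu' <;> rcases Finset.mem_insert.1 hw with rfl | hw'
  · exact hv.2.1
  · exact (hv.2.2 w hw').symm
  · exact hv.2.2 u hu'
  · exact joined_of_mem_facet X (hσ hu') (hσ hw')

-- Here the link of `σ` is zero-dimensional, and a single step exchanges its point in `X` for one in
-- `S`.
open Classical in
theorem exists_segment_of_card_eq (hK : K.IsNormalFlag N) {σ : Finset V} (hN : σ.card + 1 = N) :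
    K.HasSegments σ := by
  intro X S hσ hS hSσ hXS
  obtain ⟨s, hs⟩ := hS
  obtain ⟨Y, hY⟩ := hK.exists_facet_insert hσ (hSσ s hs)
  have hsσ := (hSσ s hs).1
  have hYeq : insert s σ = Y.1 := Finset.eq_of_subset_of_card_le hY (by
    rw [hK.card_eq Y, Finset.card_insert_of_notMem hsσ, hN])
  have hsX : s ∉ X.1 := fun h => hXS s h hs
  have hXY : X.1 ∩ Y.1 = σ := by
    rw [← hYeq, Finset.inter_insert_of_notMem hsX, Finset.inter_eq_right.2 hσ]
  have hadj : K.dualGraph.Adj X Y := by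
    constructor
    · rw [hK.card_eq X, ← hN, ← hXY]
    · rw [hK.card_eq Y, ← hN, ← hXY]
  refine ⟨Y, s, _, .of_adj hadj, fun v hv => hY (Finset.mem_insert_of_mem hv),
    hY (Finset.mem_insert_self _ _), hs, ?_, ?_⟩
  · rintro v (hv | hv) hvs
    · by_contra hvY
      have hvσ : v ∉ σ := fun h => hvY (hY (Finset.mem_insert_of_mem h))
      have hXeq : insert v σ = X.1 := Finset.eq_of_subset_of_card_le
        (Finset.insert_subset hv hσ) (by
          rw [hK.card_eq X, Finset.card_insert_of_notMem hvσ, hN])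
      -- If the point of `X` outside `σ` were joined to `s`, then `X` and `s` would form a clique
      -- with more than `N` elements.
      obtain ⟨Z, hZ⟩ := hK.exists_facet_insert (X := X) (σ := X.1) subset_rfl (v := s)
        ⟨hsX, (hSσ s hs).2.1, fun u hu => by
          rw [← hXeq] at hu
          rcases Finset.mem_insert.1 hu with rfl | hu
          · exact hvs
          · exact (hSσ s hs).2.2 u hu⟩
      have := Finset.card_le_card hZ
      rw [Finset.card_insert_of_notMem hsX, hK.card_eq, hK.card_eq] at this
      lia
    · exact hv
  · rintro v (hv | hv) hvS
    · exact absurd hvS (hXS v hv)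
    · rw [← hYeq] at hv
      rcases Finset.mem_insert.1 hv with rfl | hv
      · rfl
      · exact absurd hv (hSσ v hvS).1

-- Each leg is a segment in the star of a vertex `x` of minimal `δ`, ending at a vertex one step
-- closer to `S`. The last two conclusions are what gluing needs: on the remaining path, a vertex
-- above the level of its starting vertex is joined to that vertex.
open Classical in
theorem exists_segment_of_distance {σ : Finset V} {S : Set V}
    {δ : V → ℕ} (hδ : K.IsDistance σ S δ) (hS : ∀ v ∈ S, K.LinkVertex σ v)
    (ih : ∀ x ∉ σ, K.HasSegments (insert x σ)) (k : ℕ) :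
    ∀ (X : K.facets) (x : V), σ ⊆ X.1 → x ∈ X.1 → x ∉ σ → δ x = k + 1 →
      (∀ v ∈ X.1, v ∉ σ → k + 1 ≤ δ v) →
      ∃ Y y U, K.IsSegment σ X S Y y U ∧ (∀ v ∈ U, v ∉ σ → δ v ≤ k + 2) ∧
        ∀ v ∈ U, v ∉ σ → k + 1 < δ v → K.Joined x v := by
  induction k with
  | zero =>
    intro X x hσ hxX hxσ hx hmin
    have hxl := linkVertex_of_mem_facet X hσ hxX hxσ
    obtain ⟨w, hw, hxw, hw0⟩ := hδ.exists_pred x 0 hxl hx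
    have hxS : x ∉ S := fun h => by have := hδ.eq_zero x h; lia
    obtain ⟨Y, y, U, hU⟩ := ih x hxσ X {v | v ∈ S ∧ K.Joined x v}
      (Finset.insert_subset hxX hσ) ⟨w, hδ.mem_of_eq_zero w hw hw0, hxw⟩
      (by
        rintro v ⟨hv, hxv⟩
        refine ⟨?_, (hS v hv).2.1, ?_⟩
        · rw [Finset.mem_insert]
          rintro (rfl | h)
          · exact hxS hv
          · exact (hS v hv).1 h
        · intro u hu
          rcases Finset.mem_insert.1 hu with rfl | hu
          · exact hxv
          · exact (hS v hv).2.2 u hu)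
      (by
        rintro v hv ⟨hvS, -⟩
        have := hmin v hv (hS v hvS).1
        have := hδ.eq_zero v hvS
        lia)
    have hxY : x ∈ Y.1 := hU.subset (Finset.mem_insert_self _ _)
    have hσY : σ ⊆ Y.1 := fun v hv => hU.subset (Finset.mem_insert_of_mem hv)
    refine ⟨Y, y, U, ⟨hU.path, hσY, hU.mem, hU.mem_target.1, hU.mem_of_joined,
      fun v hv hvS => hU.eq_of_mem v hv ⟨hvS, hU.path.joined hv hxX hxY⟩⟩, ?_, ?_⟩
    · intro v hv hvσ
      have := hδ.le_succ v x (hU.path.linkVertex hv hσ hσY hvσ) hxl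
        (hU.path.joined hv hxX hxY).symm
      lia
    · intro v hv _ _
      exact hU.path.joined hv hxX hxY
  | succ k IH =>
    intro X x hσ hxX hxσ hx hmin
    have hxl := linkVertex_of_mem_facet X hσ hxX hxσ
    obtain ⟨w, hw, hxw, hwk⟩ := hδ.exists_pred x (k + 1) hxl hx
    obtain ⟨Z, z, U₁, h₁⟩ := ih x hxσ X {v | K.LinkVertex σ v ∧ K.Joined x v ∧ δ v = k + 1}
      (Finset.insert_subset hxX hσ) ⟨w, hw, hxw, hwk⟩
      (by
        rintro v ⟨hv, hxv, hvk⟩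
        refine ⟨?_, hv.2.1, ?_⟩
        · rw [Finset.mem_insert]
          rintro (rfl | h)
          · lia
          · exact hv.1 h
        · intro u hu
          rcases Finset.mem_insert.1 hu with rfl | hu
          · exact hxv
          · exact hv.2.2 u hu)
      (by
        rintro v hv ⟨hvl, -, hvk⟩
        have := hmin v hv hvl.1
        lia)
    have hxZ : x ∈ Z.1 := h₁.subset (Finset.mem_insert_self _ _)
    have hσZ : σ ⊆ Z.1 := fun v hv => h₁.subset (Finset.mem_insert_of_mem hv)
    obtain ⟨hzl, hxz, hzk⟩ := h₁.mem_target
    have hlink₁ : ∀ v ∈ U₁, v ∉ σ → K.LinkVertex σ v := fun v hv hvσ =>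
      h₁.path.linkVertex hv hσ hσZ hvσ
    have hjoin₁ : ∀ v ∈ U₁, K.Joined x v := fun v hv => h₁.path.joined hv hxX hxZ
    have hge₁ : ∀ v ∈ U₁, v ∉ σ → k + 1 ≤ δ v := fun v hv hvσ => by
      have := hδ.le_succ x v hxl (hlink₁ v hv hvσ) (hjoin₁ v hv)
      lia
    have hle₁ : ∀ v ∈ U₁, v ∉ σ → δ v ≤ k + 3 := fun v hv hvσ => by
      have := hδ.le_succ v x (hlink₁ v hv hvσ) hxl (hjoin₁ v hv).symm
      lia
    have heq₁ : ∀ v ∈ U₁, v ∉ σ → δ v = k + 1 → v = z := fun v hv hvσ hvk =>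
      h₁.eq_of_mem v hv ⟨hlink₁ v hv hvσ, hjoin₁ v hv, hvk⟩
    obtain ⟨Y, y, U₂, h₂, hle₂, hjoin₂⟩ := IH Z z hσZ h₁.mem hzl.1 hzk
      (fun v hv hvσ => hge₁ v (h₁.path.mem_of_mem_right hv) hvσ)
    have hyl := hS y h₂.mem_target
    have hy0 := hδ.eq_zero y h₂.mem_target
    refine ⟨Y, y, U₁ ∪ U₂, ⟨h₁.path.trans h₂.path ?_, h₂.subset, h₂.mem, h₂.mem_target, ?_, ?_⟩,
      ?_, ?_⟩
    -- A vertex of both legs is in `σ`, or at level `k + 1` and hence equal to `z`, or higher; in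
    -- the last case the second leg makes it joined to `z`, and the first leg then puts it in `Z`.
    · intro v hv₁ hv₂
      by_cases hvσ : v ∈ σ
      · exact hσZ hvσ
      rcases (hge₁ v hv₁ hvσ).eq_or_lt with h | h
      · rw [heq₁ v hv₁ hvσ h.symm]
        exact h₁.mem
      · exact h₁.mem_of_joined v hv₁ (hjoin₂ v hv₂ hvσ h).symm
    · rintro v (hv | hv) hvy
      · by_cases hvσ : v ∈ σ
        · exact h₂.subset hvσ
        have h := hδ.le_succ v y (hlink₁ v hv hvσ) hyl hvy
        have h' := hge₁ v hv hvσ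
        -- Being joined to `y` forces `δ v ≤ 1`, so `k = 0` and `v = z`.
        rw [heq₁ v hv hvσ (by lia)] at hvy ⊢
        exact h₂.mem_of_joined z (h₂.path.mem_of_mem_left h₁.mem) hvy
      · exact h₂.mem_of_joined v hv hvy
    · rintro v (hv | hv) hvS
      · have := hge₁ v hv (hS v hvS).1
        have := hδ.eq_zero v hvS
        lia
      · exact h₂.eq_of_mem v hv hvS
    · rintro v (hv | hv) hvσ
      · exact hle₁ v hv hvσ
      · have := hle₂ v hv hvσ
        lia
    · rintro v (hv | hv) hvσ hvk
      · exact hjoin₁ v hv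
      · have := hle₂ v hv hvσ
        lia

/-- Reachability is essential: `sInf ∅ = 0` would place unreachable vertices at distance zero. -/
theorem isDistance_sInf {σ : Finset V} {S : Set V}
    (h : ∀ v, K.LinkVertex σ v → ∃ n, K.Reaches σ S n v) :
    K.IsDistance σ S fun v => sInf {n | K.Reaches σ S n v} := by
  have hmem : ∀ v, K.LinkVertex σ v → K.Reaches σ S (sInf {n | K.Reaches σ S n v}) v :=
    fun v hv => Nat.sInf_mem (h v hv)
  have hle : ∀ v n, K.Reaches σ S n v → sInf {n | K.Reaches σ S n v} ≤ n :=
    fun v n hn => Nat.sInf_le hn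
  refine ⟨fun v hv hv0 => ?_, fun v hv => ?_, fun u v hu hv huv => ?_, fun v k hv hvk => ?_⟩
  · have := hmem v hv
    rw [hv0] at this
    cases this
    assumption
  · exact Nat.le_zero.1 (hle v 0 (.zero v hv))
  · exact hle u _ (.succ _ u v (hmem v hv) hu hv huv)
  · have := hmem v hv
    rw [hvk] at this
    rcases this with _ | ⟨_, _, w, hw, -, hwl, hvw⟩
    refine ⟨w, hwl, hvw, le_antisymm (hle w k hw) ?_⟩
    have := hle v _ (.succ _ v w (hmem w hwl) hv hwl hvw)
    lia

-- Adjacent facets share `N - 1 > σ.card` elements, hence a vertex outside `σ`; so a facet walk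
-- through the star of `σ` yields a vertex walk in the link.
open Classical in
theorem exists_reaches (hK : K.IsNormalFlag N) {σ : Finset V} (hN : σ.card + 1 < N) {S : Set V}
    (hS : S.Nonempty) (hSσ : ∀ v ∈ S, K.LinkVertex σ v) {X₀ : K.facets} (hX₀ : σ ⊆ X₀.1) (v : V)
    (hv : K.LinkVertex σ v) : ∃ n, K.Reaches σ S n v := by
  obtain ⟨s, hs⟩ := hS
  obtain ⟨Y, hY⟩ := hK.exists_facet_insert hX₀ (hSσ s hs)
  obtain ⟨X, hX⟩ := hK.exists_facet_insert hX₀ hv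
  have hσY : σ ⊆ Y.1 := (Finset.subset_insert _ _).trans hY
  have hσX : σ ⊆ X.1 := (Finset.subset_insert _ _).trans hX
  have hwalk := hK.connected σ Y X hσY hσX
  have key : ∀ Z : K.facets,
      Relation.ReflTransGen (fun A B : K.facets => K.dualGraph.Adj A B ∧ σ ⊆ B.1) Y Z →
      σ ⊆ Z.1 ∧ ∀ u ∈ Z.1, u ∉ σ → ∃ n, K.Reaches σ S n u := by
    intro Z hZ
    induction hZ with
    | refl =>
      refine ⟨hσY, fun u hu huσ => ⟨1, .succ 0 u s (.zero s hs)
        (linkVertex_of_mem_facet Y hσY hu huσ) (hSσ s hs)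
        (joined_of_mem_facet Y hu (hY (Finset.mem_insert_self _ _)))⟩⟩
    | @tail A B _ hAB ih =>
      refine ⟨hAB.2, fun u hu huσ => ?_⟩
      have hcard : σ.card < (A.1 ∩ B.1).card := by
        have := hAB.1.1
        rw [hK.card_eq] at this
        lia
      obtain ⟨w, hw, hwσ⟩ := Finset.exists_mem_notMem_of_card_lt_card hcard
      rw [Finset.mem_inter] at hw
      obtain ⟨n, hn⟩ := ih.2 w hw.1 hwσ
      exact ⟨n + 1, .succ n u w hn (linkVertex_of_mem_facet B hAB.2 hu huσ)
        (linkVertex_of_mem_facet B hAB.2 hw.2 hwσ) (joined_of_mem_facet B hu hw.2)⟩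
  exact (key X hwalk).2 v (hX (Finset.mem_insert_self _ _)) hv.1

open Classical in
theorem hasSegments (hK : K.IsNormalFlag N) (σ : Finset V) : K.HasSegments σ := by
  obtain ⟨m, hm⟩ : ∃ m, m = N - σ.card := ⟨_, rfl⟩
  induction m using Nat.strong_induction_on generalizing σ with
  | _ m ih =>
  rcases lt_trichotomy (σ.card + 1) N with hN | hN | hN
  · intro X S hσ hS hSσ hXS
    have hδ := isDistance_sInf (fun v hv => hK.exists_reaches hN hS hSσ hσ v hv)
    set δ : V → ℕ := fun v => sInf {n | K.Reaches σ S n v}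
    have hne : (X.1 \ σ).Nonempty := by
      rw [← Finset.card_pos, Finset.card_sdiff_of_subset hσ, hK.card_eq]
      lia
    obtain ⟨x, hx, hmin⟩ := Finset.exists_min_image _ δ hne
    rw [Finset.mem_sdiff] at hx
    have hx0 : δ x ≠ 0 := fun h =>
      hXS x hx.1 (hδ.mem_of_eq_zero x (linkVertex_of_mem_facet X hσ hx.1 hx.2) h)
    obtain ⟨k, hk⟩ := Nat.exists_eq_succ_of_ne_zero hx0
    obtain ⟨Y, y, U, hU, -⟩ := exists_segment_of_distance hδ hSσ
      (fun v hv => ih (N - (insert v σ).card)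
        (by rw [Finset.card_insert_of_notMem hv]; lia) _ rfl) k X x hσ hx.1 hx.2 hk
      (fun v hv hvσ => hk.symm.le.trans (hmin v (Finset.mem_sdiff.2 ⟨hv, hvσ⟩)))
    exact ⟨Y, y, U, hU⟩
  · exact hK.exists_segment_of_card_eq hN
  -- Void case: a facet containing `σ` and `s` would have more than `N` elements.
  · intro X S hσ ⟨s, hs⟩ hSσ hXS
    obtain ⟨Y, hY⟩ := hK.exists_facet_insert hσ (hSσ s hs)
    have h₁ := Finset.card_le_card hY
    rw [Finset.card_insert_of_notMem (hSσ s hs).1, hK.card_eq] at h₁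
    lia

/-! ### Non-revisiting paths between facets -/

open Classical in
/-- Any two facets of a normal flag complex that contain `σ` are connected by a non-revisiting
path. -/
theorem exists_nonRevisitingPath (hK : K.IsNormalFlag N) (σ : Finset V) :
    ∀ X Y : K.facets, σ ⊆ X.1 → σ ⊆ Y.1 → ∃ U, K.NonRevisitingPath X Y U := by
  obtain ⟨m, hm⟩ : ∃ m, m = N - σ.card := ⟨_, rfl⟩
  induction m using Nat.strong_induction_on generalizing σ with
  | _ m ih =>
  intro X Y hX hY
  by_cases hXY : X = Y
  · subst hXY
    exact ⟨_, .refl X⟩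
  have hlt : ∀ y ∈ Y.1, y ∉ σ → N - (insert y σ).card < m := fun y hy hyσ => by
    have := Finset.card_le_card (Finset.insert_subset hy hY)
    rw [Finset.card_insert_of_notMem hyσ, hK.card_eq] at this
    rw [Finset.card_insert_of_notMem hyσ]
    lia
  by_cases hdisj : ∀ v ∈ X.1, v ∉ {v | v ∈ Y.1 ∧ v ∉ σ}
  · have hne : ∃ y ∈ Y.1, y ∉ σ := by
      by_contra! h
      have hYσ : Y.1 = σ := Finset.Subset.antisymm h hY
      exact hXY (Subtype.ext (Finset.eq_of_subset_of_card_le (hYσ ▸ hX)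
        (by rw [hK.card_eq, hK.card_eq])).symm)
    obtain ⟨Z, z, U₁, h₁⟩ := hK.hasSegments σ X {v | v ∈ Y.1 ∧ v ∉ σ} hX hne
      (fun v hv => linkVertex_of_mem_facet Y hY hv.1 hv.2) hdisj
    obtain ⟨hzY, hzσ⟩ := h₁.mem_target
    obtain ⟨U₂, h₂⟩ := ih _ (hlt z hzY hzσ) _ rfl Z Y (Finset.insert_subset h₁.mem h₁.subset)
      (Finset.insert_subset hzY hY)
    -- All facets of the second leg contain `z`, so a vertex of both legs is joined to `z` and the
    -- segment property puts it in `Z`.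
    exact ⟨_, h₁.path.trans h₂ fun v hv₁ hv₂ =>
      h₁.mem_of_joined v hv₁ (h₂.joined hv₂ h₁.mem hzY).symm⟩
  · push Not at hdisj
    obtain ⟨y, hyX, hyY, hyσ⟩ := hdisj
    exact ih _ (hlt y hyY hyσ) _ rfl X Y (Finset.insert_subset hyX hX)
      (Finset.insert_subset hyY hY)

end IsNormalFlag

/-- A facet lies in the star of a vertex if and only if it contains it. -/
theorem mem_star_singleton_iff {K : PreAbstractSimplicialComplex V} (X : K.facets) (v : V) :
    X.1 ∈ K.star {v} ↔ v ∈ X.1 := by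
  classical
  constructor
  · rintro ⟨-, h⟩
    have h' : X.1 ∪ {v} ∈ K.faces := by convert h
    exact X.2.le_of_ge h' Finset.subset_union_left (Finset.mem_union_right _ (by simp))
  · intro h
    refine ⟨X.2.prop, ?_⟩
    have : X.1 ∪ {v} = X.1 := Finset.union_eq_left.2 (by simpa using h)
    convert X.2.prop

theorem IsNormalFlag.hasNonRevisitingPathProperty {K : PreAbstractSimplicialComplex V} {N : ℕ}
    (hK : K.IsNormalFlag N) : K.HasNonRevisitingPathProperty := by
  refine ⟨fun s hs t ht => (hK.card_eq ⟨s, hs⟩).trans (hK.card_eq ⟨t, ht⟩).symm, fun X Y => ?_⟩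
  obtain ⟨U, p, hp, -⟩ := hK.exists_nonRevisitingPath ∅ X Y (by simp) (by simp)
  refine ⟨p, fun v _ i j _ _ hi hj k hik hkj => ?_⟩
  rw [mem_star_singleton_iff] at hi hj ⊢
  exact hp v i j k hik hkj hi hj

/-! ### The diameter bound, and cliques in flag complexes -/

open Classical in
/-- A non-revisiting facet path meets a new vertex in every step. -/
theorem IsNonRevisiting.length_add_card_le {K : PreAbstractSimplicialComplex V} {X Y : K.facets}
    {p : K.dualGraph.Walk X Y} (hp : K.IsNonRevisiting p) {W : Finset V}
    (hW : ∀ Z : K.facets, Z.1 ⊆ W) : p.length + X.1.card ≤ W.card := by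
  have key : ∀ n ≤ p.length,
      n + X.1.card ≤ ((Finset.range (n + 1)).biUnion fun i => (p.getVert i).1).card := by
    intro n
    induction n with
    | zero => simp
    | succ n ih =>
      intro hn
      have hadj := p.adj_getVert_succ (show n < p.length by lia)
      have hlt : ((p.getVert n).1 ∩ (p.getVert (n + 1)).1).card < (p.getVert (n + 1)).1.card := by
        have := hadj.2
        lia
      obtain ⟨v, hv, hvn⟩ := Finset.exists_mem_notMem_of_card_lt_card hlt
      have hvn : v ∉ (p.getVert n).1 := fun h => hvn (Finset.mem_inter.2 ⟨h, hv⟩)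
      have hvK : v ∈ K.vertices := (K.isRelLowerSet_faces (p.getVert (n + 1)).2.prop).2
        (Finset.singleton_subset_iff.2 hv) (Finset.singleton_nonempty v)
      have hnew : v ∉ (Finset.range (n + 1)).biUnion fun i => (p.getVert i).1 := by
        rw [Finset.mem_biUnion]
        rintro ⟨i, hi, hvi⟩
        rw [Finset.mem_range] at hi
        have := hp v hvK i (n + 1) (by lia) hn ((mem_star_singleton_iff _ _).2 hvi)
          ((mem_star_singleton_iff _ _).2 hv) n (by lia) (by lia)
        exact hvn ((mem_star_singleton_iff _ _).1 this)
      have hcard := Finset.card_le_card (show insert v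
          ((Finset.range (n + 1)).biUnion fun i => (p.getVert i).1) ⊆
          (Finset.range (n + 1 + 1)).biUnion fun i => (p.getVert i).1 from
        Finset.insert_subset (Finset.mem_biUnion.2 ⟨n + 1, by simp, hv⟩)
          (Finset.biUnion_subset_biUnion_of_subset_left _
            (Finset.range_subset_range.2 (by lia))))
      rw [Finset.card_insert_of_notMem hnew] at hcard
      have := ih (by lia)
      lia
  exact (key _ le_rfl).trans (Finset.card_le_card (Finset.biUnion_subset.2 fun i _ => hW _))

open Classical in
/-- In a flag complex, a nonempty clique is a face. -/
theorem IsFlag.mem_faces {K : PreAbstractSimplicialComplex V} (hK : K.IsFlag) (s : Finset V)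
    (hs : s.Nonempty) (h : ∀ u ∈ s, ∀ v ∈ s, K.Joined u v) : s ∈ K.faces := by
  induction s using Finset.strongInduction with
  | H s ih =>
  by_contra hsK
  have hpair : ∀ u ∈ s, ∀ v ∈ s, {u, v} ∈ K.faces := fun u hu v hv => by
    obtain ⟨t, ht, hut, hvt⟩ := h u hu v hv
    exact (K.isRelLowerSet_faces ht).2
      (Finset.insert_subset hut (Finset.singleton_subset_iff.2 hvt)) ⟨u, by simp⟩
  -- By induction `s` is a minimal non-face, hence a pair; but joined pairs are faces.
  have := hK s ⟨hs, fun v hv => by simpa [vertices] using hpair v hv v hv, hsK,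
    fun t hts ht => ih t hts ht fun u hu v hv => h u (hts.1 hu) v (hts.1 hv)⟩
  obtain ⟨u, v, -, rfl⟩ := Finset.card_eq_two.1 this
  exact hsK (hpair u (by simp) v (by simp))

end PreAbstractSimplicialComplex

/-! ### Complexes given by supporting functionals -/

section Functional

variable {V E : Type*} [AddCommGroup E] [Module ℝ E]

/-- The functional `φ` is at most `1` on the vectors `u v`, `v ∈ W`, with equality exactly for
`v ∈ s`. -/
def IsSupporting (W : Finset V) (u : V → E) (φ : E →ₗ[ℝ] ℝ) (s : Finset V) : Prop :=
  (∀ v ∈ W, φ (u v) ≤ 1) ∧ ∀ v, v ∈ s ↔ v ∈ W ∧ φ (u v) = 1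

/-- Rotating a supporting functional in the direction `m` until it meets a new vector. -/
theorem IsSupporting.exists_pivot {W : Finset V} {u : V → E} (hW : ∑ v ∈ W, u v = 0)
    {φ : E →ₗ[ℝ] ℝ} {s : Finset V} (hφ : IsSupporting W u φ s) {m : E →ₗ[ℝ] ℝ}
    (hm : ∀ v ∈ s, m (u v) ≤ 0) (hm0 : ∃ v ∈ W, m (u v) ≠ 0) :
    ∃ t : ℝ, 0 < t ∧ ∃ s' : Finset V, IsSupporting W u (φ + t • m) s' ∧ (∃ w ∈ s', w ∉ s) ∧
      ∀ v ∈ s, m (u v) = 0 → v ∈ s' := by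
  classical
  -- The values of `m` sum to zero over `W`, so one nonzero value forces a positive one.
  have hpos : (W.filter fun v => 0 < m (u v)).Nonempty := by
    by_contra h
    rw [Finset.not_nonempty_iff_eq_empty, Finset.filter_eq_empty_iff] at h
    obtain ⟨v, hv, hmv⟩ := hm0
    have hsum : ∑ v ∈ W, m (u v) = 0 := by rw [← map_sum, hW, map_zero]
    exact hmv ((Finset.sum_eq_zero_iff_of_nonpos fun v hv => not_lt.1 (h hv)).1 hsum v hv)
  -- Ratio test: the first `t` at which a vector with `m > 0` reaches the value `1`.
  obtain ⟨w, hw, hmin⟩ := Finset.exists_min_image _ (fun v => (1 - φ (u v)) / m (u v)) hpos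
  rw [Finset.mem_filter] at hw
  have hws : w ∉ s := fun h => absurd hw.2 (not_lt.2 (hm w h))
  have hlt : φ (u w) < 1 := lt_of_le_of_ne (hφ.1 w hw.1) fun h => hws ((hφ.2 w).2 ⟨hw.1, h⟩)
  set t := (1 - φ (u w)) / m (u w) with ht
  have htpos : 0 < t := div_pos (by linarith) hw.2
  refine ⟨t, htpos, W.filter fun v => (φ + t • m) (u v) = 1, ⟨fun v hv => ?_, fun v => ?_⟩,
    ⟨w, ?_, hws⟩, fun v hv hmv => ?_⟩
  · simp only [LinearMap.add_apply, LinearMap.smul_apply, smul_eq_mul]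
    have hφv := hφ.1 v hv
    rcases le_or_gt (m (u v)) 0 with h | h
    · nlinarith
    · have := hmin v (Finset.mem_filter.2 ⟨hv, h⟩)
      rw [le_div_iff₀ h] at this
      linarith
  · simp
  · simp only [Finset.mem_filter, LinearMap.add_apply, LinearMap.smul_apply, smul_eq_mul]
    refine ⟨hw.1, ?_⟩
    rw [ht, div_mul_cancel₀ _ hw.2.ne']
    ring
  · simp only [Finset.mem_filter, LinearMap.add_apply, LinearMap.smul_apply, smul_eq_mul, hmv]
    have := (hφ.2 v).1 hv
    exact ⟨this.1, by linarith [this.2]⟩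

/-- The faces of `K` are the nonempty sets cut out by supporting functionals of a balanced vector
configuration, and each of them is linearly independent. -/
structure IsSupportComplex (K : PreAbstractSimplicialComplex V) (W : Finset V) (u : V → E) :
    Prop where
  sum_eq_zero : ∑ v ∈ W, u v = 0
  exists_supporting : ∀ s ∈ K.faces, ∃ φ, IsSupporting W u φ s
  mem_faces : ∀ φ s, IsSupporting W u φ s → s.Nonempty → s ∈ K.faces
  linearIndepOn : ∀ s ∈ K.faces, LinearIndepOn ℝ u (s : Set V)

namespace IsSupportComplex

variable {K : PreAbstractSimplicialComplex V} {W : Finset V} {u : V → E}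

theorem subset (hK : IsSupportComplex K W u) {s : Finset V} (hs : s ∈ K.faces) : s ⊆ W := by
  obtain ⟨φ, hφ⟩ := hK.exists_supporting s hs
  exact fun v hv => ((hφ.2 v).1 hv).1

theorem card_eq_finrank_span (hK : IsSupportComplex K W u) {s : Finset V} (hs : s ∈ K.faces) :
    s.card = Module.finrank ℝ (Submodule.span ℝ (u '' s)) := by
  have := finrank_span_eq_card (hK.linearIndepOn s hs)
  rw [Set.image_eq_range]
  exact (this.trans (Fintype.card_coe s)).symm

theorem card_le (hK : IsSupportComplex K W u) {s : Finset V} (hs : s ∈ K.faces) :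
    s.card ≤ Module.finrank ℝ (Submodule.span ℝ (u '' W)) := by
  rw [hK.card_eq_finrank_span hs]
  have : FiniteDimensional ℝ (Submodule.span ℝ (u '' W)) :=
    FiniteDimensional.span_of_finite ℝ (W.finite_toSet.image u)
  exact Submodule.finrank_mono (Submodule.span_mono (Set.image_mono (hK.subset hs)))

/-- Otherwise a functional vanishing on `X` but not on all of `W` could be used to pivot to a
strictly larger face. -/
theorem span_facet (hK : IsSupportComplex K W u) (X : K.facets) :
    Submodule.span ℝ (u '' X.1) = Submodule.span ℝ (u '' W) := by
  refine le_antisymm (Submodule.span_mono (Set.image_mono (hK.subset X.2.prop)))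
    (Submodule.span_le.2 ?_)
  rintro _ ⟨w, hw, rfl⟩
  by_contra hwX
  obtain ⟨m, hmw, hmX⟩ := Submodule.exists_le_ker_of_notMem hwX
  have hm : ∀ v ∈ X.1, m (u v) = 0 := fun v hv =>
    hmX (Submodule.subset_span (Set.mem_image_of_mem u hv))
  obtain ⟨φ, hφ⟩ := hK.exists_supporting X.1 X.2.prop
  obtain ⟨_, -, s', hs', ⟨w', hw', hwX'⟩, hX⟩ :=
    hφ.exists_pivot hK.sum_eq_zero (fun v hv => (hm v hv).le) ⟨w, hw, hmw⟩
  exact hwX' (X.2.le_of_ge (hK.mem_faces _ _ hs' ⟨w', hw'⟩) (fun v hv => hX v hv (hm v hv)) hw')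

theorem card_facet (hK : IsSupportComplex K W u) (X : K.facets) :
    X.1.card = Module.finrank ℝ (Submodule.span ℝ (u '' W)) := by
  rw [hK.card_eq_finrank_span X.2.prop, hK.span_facet]

theorem mem_facets (hK : IsSupportComplex K W u) {s : Finset V} (hs : s ∈ K.faces)
    (hcard : Module.finrank ℝ (Submodule.span ℝ (u '' W)) ≤ s.card) : s ∈ K.facets :=
  ⟨hs, fun _ ht hst => (Finset.eq_of_subset_of_card_le hst ((hK.card_le ht).trans hcard)).ge⟩

theorem exists_facet_superset (hK : IsSupportComplex K W u) {s : Finset V} (hs : s ∈ K.faces) :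
    ∃ X : K.facets, s ⊆ X.1 := by
  have hfin : {t | t ∈ K.faces}.Finite :=
    (W.powerset.finite_toSet).subset fun _ ht => by simpa using hK.subset ht
  obtain ⟨X, hsX, hX⟩ := hfin.exists_le_maximal hs
  exact ⟨⟨X, hX⟩, hsX⟩

open Classical in
/-- Across every ridge of a facet `X` there is another facet, on which the value of the supporting
functional at a point beyond the ridge is larger. -/
theorem exists_adj (hK : IsSupportComplex K W u) (X : K.facets) {φ : E →ₗ[ℝ] ℝ}
    (hφ : IsSupporting W u φ X.1) (a : V → ℝ) {v : V} (hv : v ∈ X.1) (hav : a v < 0) :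
    ∃ (Y : K.facets) (ψ : E →ₗ[ℝ] ℝ), K.dualGraph.Adj X Y ∧ X.1.erase v ⊆ Y.1 ∧
      IsSupporting W u ψ Y.1 ∧ φ (∑ x ∈ X.1, a x • u x) < ψ (∑ x ∈ X.1, a x • u x) := by
  have hind := (linearIndepOn_iff_notMem_span.1 (hK.linearIndepOn X.1 X.2.prop)) v hv
  obtain ⟨m₀, hm₀v, hm₀⟩ := Submodule.exists_le_ker_of_notMem hind
  -- On `X` this is minus the coordinate dual to `v`: pivoting along it drops `v` and keeps the
  -- ridge.
  set m : E →ₗ[ℝ] ℝ := (-(m₀ (u v))⁻¹) • m₀ with hm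
  have hmv : m (u v) = -1 := by simp [hm, hm₀v]
  have hmx : ∀ x ∈ X.1, x ≠ v → m (u x) = 0 := fun x hx hxv => by
    have : m₀ (u x) = 0 := hm₀ (Submodule.subset_span (Set.mem_image_of_mem u ⟨hx, hxv⟩))
    simp [hm, this]
  have hmle : ∀ x ∈ X.1, m (u x) ≤ 0 := fun x hx => by
    by_cases hxv : x = v
    · rw [hxv, hmv]; norm_num
    · exact (hmx x hx hxv).le
  obtain ⟨t, ht, s', hs', ⟨w, hw, hwX⟩, hX⟩ := hφ.exists_pivot hK.sum_eq_zero hmle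
    ⟨v, hK.subset X.2.prop hv, by rw [hmv]; norm_num⟩
  have hs'K := hK.mem_faces _ _ hs' ⟨w, hw⟩
  have herase : X.1.erase v ⊆ s' := fun x hx => by
    rw [Finset.mem_erase] at hx
    exact hX x hx.2 (hmx x hx.2 hx.1)
  have hvs' : v ∉ s' := fun h => by
    have h₁ := ((hs'.2 v).1 h).2
    have h₂ := ((hφ.2 v).1 hv).2
    simp only [LinearMap.add_apply, LinearMap.smul_apply, smul_eq_mul, hmv, h₂] at h₁
    linarith
  have hwe : w ∉ X.1.erase v := fun h => hwX (Finset.mem_of_mem_erase h)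
  have hcard : (insert w (X.1.erase v)).card = X.1.card := by
    rw [Finset.card_insert_of_notMem hwe, Finset.card_erase_add_one hv]
  have hle := Finset.card_le_card (Finset.insert_subset hw herase)
  rw [hcard, hK.card_facet] at hle
  let Y : K.facets := ⟨s', hK.mem_facets hs'K hle⟩
  have hinter : X.1 ∩ s' = X.1.erase v := by
    ext x
    rw [Finset.mem_inter, Finset.mem_erase]
    exact ⟨fun h => ⟨fun hxv => hvs' (hxv ▸ h.2), h.1⟩,
      fun h => ⟨h.2, herase (Finset.mem_erase.2 h)⟩⟩
  have hadj : (X.1 ∩ s').card + 1 = X.1.card := by rw [hinter, Finset.card_erase_add_one hv]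
  refine ⟨Y, φ + t • m, ⟨hadj, ?_⟩, herase, hs', ?_⟩
  · rw [hK.card_facet Y, ← hK.card_facet X]
    exact hadj
  · have : m (∑ x ∈ X.1, a x • u x) = - a v := by
      rw [map_sum, Finset.sum_eq_single_of_mem v hv]
      · simp [hmv]
      · intro x hx hxv
        simp [hmx x hx hxv]
    rw [LinearMap.add_apply, LinearMap.smul_apply, this, smul_eq_mul]
    nlinarith

/-- The facets containing `σ` are connected through such facets: the simplex method. -/
theorem reflTransGen_adj (hK : IsSupportComplex K W u) (σ : Finset V) (X Y : K.facets)
    (hX : σ ⊆ X.1) (hY : σ ⊆ Y.1) :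
    Relation.ReflTransGen (fun A B : K.facets => K.dualGraph.Adj A B ∧ σ ⊆ B.1) X Y := by
  classical
  choose φ hφ using fun Z : K.facets => hK.exists_supporting Z.1 Z.2.prop
  have hfin : Finite K.facets :=
    ((W.powerset.finite_toSet).subset fun _ ht => by simpa using hK.subset ht.prop).to_subtype
  -- The objective: `φ Z c ≤ φ Y c` for every facet `Z`, with equality only for `Z = Y`.
  set c : E := ∑ y ∈ Y.1, u y with hc
  have hspan : ∀ Z : K.facets, c ∈ Submodule.span ℝ (u '' Z.1) := fun Z => by
    rw [hK.span_facet Z, ← hK.span_facet Y]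
    exact Submodule.sum_mem _ fun y hy => Submodule.subset_span (Set.mem_image_of_mem u hy)
  let R : Set K.facets := {Z |
    Relation.ReflTransGen (fun A B : K.facets => K.dualGraph.Adj A B ∧ σ ⊆ B.1) X Z}
  obtain ⟨Z, hZR, hZmax⟩ := Set.exists_max_image R (fun Z => φ Z c) R.toFinite ⟨X, .refl⟩
  have hσZ : σ ⊆ Z.1 := by
    rcases Relation.ReflTransGen.cases_tail hZR with h | ⟨_, -, h⟩
    · rw [h]; exact hX
    · exact h.2
  obtain ⟨a, ha⟩ := (Submodule.mem_span_image_finset_iff_exists_fun' ℝ).1 (hspan Z)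
  -- A negative coefficient outside `σ` would allow a pivot that keeps `σ` and increases the
  -- objective.
  have hnonneg : ∀ z ∈ Z.1, z ∉ σ → 0 ≤ a z := by
    intro z hz hzσ
    by_contra! haz
    obtain ⟨Z', ψ, hadj, hsub, hψ, hlt⟩ := hK.exists_adj Z (hφ Z) a hz haz
    have hσZ' : σ ⊆ Z'.1 := fun x hx =>
      hsub (Finset.mem_erase.2 ⟨fun h => hzσ (h ▸ hx), hσZ hx⟩)
    -- Both functionals are `1` on `Z'`, whose span contains `c`.
    have heq : ψ c = φ Z' c := by
      have : Set.EqOn ψ (φ Z') (u '' Z'.1) := by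
        rintro _ ⟨x, hx, rfl⟩
        rw [((hψ.2 x).1 hx).2, (((hφ Z').2 x).1 hx).2]
      exact LinearMap.eqOn_span this (hspan Z')
    rw [ha, heq] at hlt
    exact absurd (hZmax Z' (Relation.ReflTransGen.tail hZR ⟨hadj, hσZ'⟩)) (not_le.2 hlt)
  have hone : ∀ (A : K.facets), ∀ x ∈ A.1, φ A (u x) = 1 := fun A x hx => (((hφ A).2 x).1 hx).2
  have hle : ∀ (A : K.facets), ∀ x ∈ W, φ A (u x) ≤ 1 := fun A x hx => (hφ A).1 x hx
  have h₁ : φ Y c ≤ φ Z c := by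
    rw [← ha]
    simp only [map_sum, map_smul, smul_eq_mul]
    refine Finset.sum_le_sum fun z hz => ?_
    rw [hone Z z hz]
    by_cases hzσ : z ∈ σ
    -- Coefficients on `σ` may be negative, but there `φ Y` equals `1` as well.
    · rw [hone Y z (hY hzσ)]
    · exact mul_le_mul_of_nonneg_left (hle Y z (hK.subset Z.2.prop hz)) (hnonneg z hz hzσ)
  have hYZ : Y.1 ⊆ Z.1 := by
    have h₂ : ∀ y ∈ Y.1, φ Z (u y) ≤ φ Y (u y) := fun y hy => by
      rw [hone Y y hy]
      exact hle Z y (hK.subset Y.2.prop hy)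
    have h₃ : ∑ y ∈ Y.1, φ Z (u y) = ∑ y ∈ Y.1, φ Y (u y) := by
      refine le_antisymm (Finset.sum_le_sum h₂) ?_
      simpa [hc, map_sum] using h₁
    intro y hy
    refine ((hφ Z).2 y).2 ⟨hK.subset Y.2.prop hy, ?_⟩
    rw [(Finset.sum_eq_sum_iff_of_le h₂).1 h₃ y hy, hone Y y hy]
  have : Y = Z := Subtype.ext (Finset.Subset.antisymm hYZ (Y.2.le_of_ge Z.2.prop hYZ))
  rw [this]
  exact hZR

theorem isNormalFlag (hK : IsSupportComplex K W u) (hflag : K.IsFlag) :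
    K.IsNormalFlag (Module.finrank ℝ (Submodule.span ℝ (u '' W))) where
  card_eq := hK.card_facet
  exists_facet s hs h := hK.exists_facet_superset (hflag.mem_faces s hs h)
  connected := hK.reflTransGen_adj

/-- Stated additively in `ℕ∞` with a finite right side, the bound also excludes infinite distances,
so it includes connectedness. -/
theorem ediam_add_finrank_le (hK : IsSupportComplex K W u)
    (h : K.HasNonRevisitingPathProperty) :
    K.dualGraph.ediam + (Module.finrank ℝ (Submodule.span ℝ (u '' W)) : ℕ∞) ≤ (W.card : ℕ∞) := by
  classical
  set N := Module.finrank ℝ (Submodule.span ℝ (u '' W))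
  have hN : N ≤ W.card := by
    have := finrank_span_finset_le_card (R := ℝ) (W.image u)
    rw [Finset.coe_image] at this
    exact this.trans Finset.card_image_le
  have hdiam : K.dualGraph.ediam ≤ ((W.card - N : ℕ) : ℕ∞) := by
    refine SimpleGraph.ediam_le_of_edist_le fun X Y => ?_
    obtain ⟨p, hp⟩ := h.2 X Y
    have := hp.length_add_card_le (W := W) fun Z => hK.subset Z.2.prop
    rw [hK.card_facet X] at this
    exact p.edist_le.trans (by exact_mod_cast (by lia : p.length ≤ W.card - N))
  calc _ ≤ ((W.card - N : ℕ) : ℕ∞) + N := by gcongr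
    _ = W.card := by exact_mod_cast Nat.sub_add_cancel hN

end IsSupportComplex

end Functional

/-! ### Boundary complexes of simplicial polytopes -/

section Polytope

variable {E : Type*} [NormedAddCommGroup E] [NormedSpace ℝ E]

theorem IsPolytope.finite_extremePoints {P : Set E} (hP : IsPolytope P) :
    (P.extremePoints ℝ).Finite := by
  obtain ⟨V, rfl⟩ := hP
  exact V.finite_toSet.subset extremePoints_convexHull_subset

theorem IsPolytope.convexHull_extremePoints {P : Set E} (hP : IsPolytope P) :
    convexHull ℝ (P.extremePoints ℝ) = P := by
  have hfin := hP.finite_extremePoints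
  obtain ⟨V, rfl⟩ := hP
  rw [← (hfin.isCompact_convexHull ℝ).isClosed.closure_eq,
    closure_convexHull_extremePoints (V.finite_toSet.isCompact_convexHull ℝ) (convex_convexHull ℝ _)]

/-- Applying `φ` to a linear dependency shows that its coefficients sum to zero, so it is an affine
dependency. -/
theorem AffineIndependent.linearIndepOn_sub {s : Finset E}
    (hs : AffineIndependent ℝ ((↑) : s → E)) {o : E} {φ : E →ₗ[ℝ] ℝ}
    (hφ : ∀ v ∈ s, φ (v - o) = 1) : LinearIndepOn ℝ (fun v => v - o) (s : Set E) := by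
  rw [linearIndepOn_finset_iff]
  intro f hf
  have hsum : ∑ v ∈ s, f v = 0 := by
    have := congrArg φ hf
    rw [map_sum, map_zero] at this
    rw [← this]
    exact Finset.sum_congr rfl fun v hv => by simp [hφ v hv]
  have hsum' : ∑ v ∈ s, f v • v = 0 := by
    simp only [smul_sub, Finset.sum_sub_distrib, ← Finset.sum_smul, hsum, zero_smul,
      sub_zero] at hf
    exact hf
  intro v hv
  have := affineIndependent_iff.1 hs Finset.univ (fun v => f v)
    (by rw [← hsum]; exact s.sum_coe_sort f)
    (by rw [← hsum']; exact s.sum_coe_sort fun v => f v • v) ⟨v, hv⟩ (Finset.mem_univ _)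
  exact this

theorem vectorSpan_convexHull_eq_span_sub {s : Set E} {o : E} (ho : o ∈ convexHull ℝ s) :
    vectorSpan ℝ (convexHull ℝ s) = Submodule.span ℝ ((fun v => v - o) '' s) := by
  rw [vectorSpan_eq_span_vsub_set_right ℝ ho]
  refine le_antisymm (Submodule.span_le.2 ?_)
    (Submodule.span_mono (Set.image_mono (subset_convexHull ℝ _)))
  set L := Submodule.span ℝ ((fun v => v - o) '' s) with hL
  have hconv : Convex ℝ {x | x + -o ∈ (L : Set E)} := L.convex.translate_preimage_left (-o)
  rintro _ ⟨x, hx, rfl⟩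
  have : x ∈ {x | x + -o ∈ (L : Set E)} := convexHull_min (fun v hv => by
    rw [Set.mem_ofPred_eq, ← sub_eq_add_neg]
    exact Submodule.subset_span (Set.mem_image_of_mem (fun v => v - o) hv)) hconv hx
  rw [Set.mem_ofPred_eq, ← sub_eq_add_neg] at this
  exact this

variable [FiniteDimensional ℝ E]

/-- Elements of `s` are zero-dimensional faces of `P`, hence extreme; conversely, extreme points of
a hull lie in the generating set. -/
theorem mem_face_iff {P : Set E} {hP : IsSimplicialPolytope P} {s : Finset E}
    (hs : s ∈ (boundaryComplex P hP).faces) (v : E) :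
    v ∈ s ↔ v ∈ P.extremePoints ℝ ∧ v ∈ convexHull ℝ (s : Set E) := by
  constructor
  · intro hv
    refine ⟨exposedPoints_subset_extremePoints ?_, subset_convexHull ℝ _ hv⟩
    rw [mem_exposedPoints_iff_exposed_singleton]
    have := hP.1.isProperFace_convexHull_subset hs.2.1 hs.2.2 (Finset.singleton_subset_iff.2 hv)
    simpa using this.1
  · rintro ⟨hv, hvs⟩
    exact extremePoints_convexHull_subset
      (inter_extremePoints_subset_extremePoints_of_subset hs.2.2.1.subset ⟨hvs, hv⟩)

/-- An exposing functional `l` is strictly smaller at the barycentre `o` than on the face, since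
otherwise it would be constant on `P`; dividing by the gap normalizes it. -/
theorem exists_isSupporting_of_mem_faces {P : Set E} {hP : IsSimplicialPolytope P} {W : Finset E}
    (hW : (W : Set E) = P.extremePoints ℝ) {o : E} (ho : ∑ v ∈ W, (v - o) = 0) {s : Finset E}
    (hs : s ∈ (boundaryComplex P hP).faces) : ∃ φ, IsSupporting W (fun v => v - o) φ s := by
  have hWP : convexHull ℝ (W : Set E) = P := by rw [hW, hP.1.convexHull_extremePoints]
  have hmem : ∀ v ∈ W, v ∈ P := fun v hv => hWP ▸ subset_convexHull ℝ _ hv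
  obtain ⟨g, hg⟩ := hs.1
  have hgF := subset_convexHull ℝ (s : Set E) hg
  obtain ⟨l, hl⟩ := hs.2.2.1 ⟨g, hgF⟩
  have hgmax : ∀ y ∈ P, l y ≤ l g := by rw [hl] at hgF; exact hgF.2
  have hsW : ∀ v, v ∈ s ↔ v ∈ W ∧ l v = l g := by
    intro v
    rw [mem_face_iff hs, ← hW, Finset.mem_coe]
    refine and_congr_right fun hv => ?_
    rw [hl]
    exact ⟨fun h => le_antisymm (hgmax v h.1) (h.2 g (hs.2.2.1.subset hgF)),
      fun h => ⟨hmem v hv, fun y hy => h ▸ hgmax y hy⟩⟩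
  have hlsum : ∑ v ∈ W, (l v - l o) = 0 := by
    simpa only [map_sum, map_sub, map_zero] using congrArg l ho
  have hlt : l o < l g := by
    by_contra! hle
    have hall : ∀ v ∈ W, l v - l o = 0 :=
      (Finset.sum_eq_zero_iff_of_nonpos fun v hv => by
        have := hgmax v (hmem v hv)
        linarith).1 hlsum
    have hgo := hall g ((hsW g).1 hg).1
    refine hs.2.2.2 (hs.2.2.1.subset.antisymm ?_)
    rw [← hWP]
    refine convexHull_mono fun v hv => (hsW v).2 ⟨hv, ?_⟩
    linarith [hall v hv]
  have hpos : 0 < l g - l o := sub_pos.2 hlt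
  refine ⟨(l g - l o)⁻¹ • l.toLinearMap, fun v hv => ?_, fun v => ?_⟩
  · simp only [LinearMap.smul_apply, ContinuousLinearMap.coe_coe, map_sub, smul_eq_mul, ← mul_sub]
    rw [inv_mul_le_one₀ hpos]
    linarith [hgmax v (hmem v hv)]
  · rw [hsW]
    refine and_congr_right fun _ => ?_
    simp only [LinearMap.smul_apply, ContinuousLinearMap.coe_coe, map_sub, smul_eq_mul, ← mul_sub]
    rw [inv_mul_eq_one₀ hpos.ne']
    constructor <;> intro h <;> linarith

/-- The maximizers of `φ` form a proper face, because values `1` on all of `W` could not sum to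
zero. Simpliciality makes this face a simplex, with vertex set `s`. -/
theorem mem_faces_of_isSupporting {P : Set E} {hP : IsSimplicialPolytope P} {W : Finset E}
    (hW : (W : Set E) = P.extremePoints ℝ) {o : E} (ho : ∑ v ∈ W, (v - o) = 0)
    {φ : E →ₗ[ℝ] ℝ} {s : Finset E} (hφ : IsSupporting W (fun v => v - o) φ s)
    (hs : s.Nonempty) : s ∈ (boundaryComplex P hP).faces := by
  have hWP : convexHull ℝ (W : Set E) = P := by rw [hW, hP.1.convexHull_extremePoints]
  have hmem : ∀ v ∈ W, v ∈ P := fun v hv => hWP ▸ subset_convexHull ℝ _ hv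
  obtain ⟨g, hg⟩ := hs
  obtain ⟨hgW, hg1⟩ := (hφ.2 g).1 hg
  rw [map_sub] at hg1
  have hle : ∀ y ∈ P, φ y ≤ φ g := by
    intro y hy
    rw [← hWP] at hy
    refine convexHull_min (t := {x | φ x ≤ φ g}) (fun v hv => ?_)
      (convex_halfSpace_le φ.isLinear _) hy
    have := hφ.1 v hv
    rw [map_sub] at this
    change φ v ≤ φ g
    linarith
  set l : E →L[ℝ] ℝ := LinearMap.toContinuousLinearMap φ with hl
  set F : Set E := {x | x ∈ P ∧ ∀ y ∈ P, l y ≤ l x} with hF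
  have hgF : g ∈ F := ⟨hmem g hgW, hle⟩
  have hface : IsProperFace P F := by
    refine ⟨fun _ => ⟨l, rfl⟩, fun hFP => ?_⟩
    have hone : ∀ v ∈ W, φ (v - o) = 1 := fun v hv => by
      have hvF : v ∈ F := hFP ▸ hmem v hv
      have h₁ : φ g ≤ φ v := hvF.2 g (hmem g hgW)
      have h₂ := hle v (hmem v hv)
      rw [map_sub]
      linarith
    have hsum : ∑ v ∈ W, φ (v - o) = 0 := by rw [← map_sum, ho, map_zero]
    rw [Finset.sum_congr rfl hone, Finset.sum_const, nsmul_eq_mul, mul_one, Nat.cast_eq_zero,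
      Finset.card_eq_zero] at hsum
    simp [hsum] at hgW
  obtain ⟨s', hs', hFs'⟩ := hP.2 F hface
  have hs'ne : s'.Nonempty := by
    rw [Finset.nonempty_iff_ne_empty]
    rintro rfl
    rw [hFs'] at hgF
    simp at hgF
  have hs'K : s' ∈ (boundaryComplex P hP).faces := ⟨hs'ne, hs', hFs' ▸ hface⟩
  have : s = s' := by
    ext v
    rw [hφ.2, mem_face_iff hs'K, ← hW, Finset.mem_coe, ← hFs']
    refine and_congr_right fun hv => ?_
    rw [map_sub]
    constructor
    · intro h
      refine ⟨hmem v hv, fun y hy => ?_⟩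
      have := hle y hy
      change φ y ≤ φ v
      linarith
    · intro h
      have h₁ : φ g ≤ φ v := h.2 g (hmem g hgW)
      have h₂ := hle v (hmem v hv)
      linarith
  exact this ▸ hs'K

theorem isSupportComplex_boundaryComplex {P : Set E} (hP : IsSimplicialPolytope P) {W : Finset E}
    (hW : (W : Set E) = P.extremePoints ℝ) {o : E} (ho : ∑ v ∈ W, (v - o) = 0) :
    IsSupportComplex (boundaryComplex P hP) W fun v => v - o where
  sum_eq_zero := ho
  exists_supporting _ hs := exists_isSupporting_of_mem_faces hW ho hs
  mem_faces _ _ hφ hs := mem_faces_of_isSupporting hW ho hφ hs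
  linearIndepOn s hs := by
    obtain ⟨φ, hφ⟩ := exists_isSupporting_of_mem_faces hW ho hs
    exact hs.2.1.linearIndepOn_sub fun v hv => ((hφ.2 v).1 hv).2

end Polytope

/-- Let `P` be a simplicial polytope whose boundary complex is flag. Then the boundary complex has
the non-revisiting path property, and the diameter of its facet-ridge graph is at most the number of
vertices of `P` minus the dimension of `P`. -/
theorem mainTheorem2 {E : Type*} [NormedAddCommGroup E] [NormedSpace ℝ E] [FiniteDimensional ℝ E]
    (P : Set E) (hP : IsSimplicialPolytope P) (hflag : (boundaryComplex P hP).IsFlag) :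
    (boundaryComplex P hP).HasNonRevisitingPathProperty ∧
      (boundaryComplex P hP).dualGraph.ediam + (Module.finrank ℝ (vectorSpan ℝ P) : ℕ∞) ≤
        (P.extremePoints ℝ).encard := by
  obtain ⟨W, hW⟩ := hP.1.finite_extremePoints.exists_finset_coe
  have hWP : convexHull ℝ (W : Set E) = P := by rw [hW, hP.1.convexHull_extremePoints]
  -- The barycentre of the vertices serves as origin, making the configuration balanced.
  set o : E := W.centerMass (fun _ => (1 : ℝ)) id with ho
  have hsum : ∑ v ∈ W, (v - o) = 0 := by
    rcases W.eq_empty_or_nonempty with rfl | hne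
    · simp
    have hcard : (W.card : ℝ) ≠ 0 := by exact_mod_cast hne.card_ne_zero
    have hcm : (W.card : ℝ) • o = ∑ v ∈ W, v := by
      simp [ho, Finset.centerMass, smul_smul, hcard]
    rw [Finset.sum_sub_distrib, Finset.sum_const, ← Nat.cast_smul_eq_nsmul ℝ, hcm, sub_self]
  have hK := isSupportComplex_boundaryComplex hP hW hsum
  have hspan : Module.finrank ℝ (vectorSpan ℝ P) =
      Module.finrank ℝ (Submodule.span ℝ ((fun v => v - o) '' (W : Set E))) := by
    rcases W.eq_empty_or_nonempty with rfl | hne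
    · rw [← hWP, Finset.coe_empty, convexHull_empty, vectorSpan_empty, Set.image_empty,
        Submodule.span_empty]
    · rw [← hWP, vectorSpan_convexHull_eq_span_sub]
      exact W.centerMass_mem_convexHull (fun _ _ => zero_le_one) (by simpa using hne.card_pos)
        fun v hv => hv
  have hpath := (hK.isNormalFlag hflag).hasNonRevisitingPathProperty
  refine ⟨hpath, ?_⟩
  rw [hspan, ← hW, Set.encard_coe_eq_coe_finsetCard]
  exact hK.ediam_add_finrank_le hpath
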